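/- Let $d\ge 1$ be an integer. For an infinite word $w=w_0w_1w_2\cdots\in\{1,\dots,d\}^{\mathbb N}$ and $n\ge 0$, let $p_w(n)$ be the number of distinct words of length $n$ that occur in $w$ as a block of $n$ consecutive letters. Say that $w$ has rationally independent letter frequencies if for every letter $a\in\{1,\dots,d\}$ the limit \[ f_a=\lim_{n\to\infty}\frac{|\{\,0\le i<n : w_i=a\,\}|}{n} \] exists, and the real numbers $f_1,\dots,f_d$ are linearly independent over $\mathbb Q$. \textbf{Theorem (Tijdeman).} Let $w\in\{1,\dots,d\}^{\mathbb N}$ be an infinite word with $p_w(1)=d$ and rationally independent letter frequencies. Then $p_w(n)\ge (d-1)n+1$ for every integer $n\ge 1$. Moreover, for every $d\ge 1$ there exists an infinite word $w\in\{1,\dots,d\}^{\mathbb N}$ with $p_w(1)=d$ and rationally independent letter frequencies such that $p_w(n)=(d-1)n+1$ for every integer $n\ge 1$. -/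

import Mathlib

/-- The finite word `u` of length `n` is a factor of the infinite word `w`:
it occurs in `w` as a block of `n` consecutive letters. -/
def IsFactor {α : Type*} {n : ℕ} (u : Fin n → α) (w : ℕ → α) : Prop :=
  ∃ i : ℕ, ∀ j : Fin n, u j = w (i + (j : ℕ))

/-- The complexity `p_w(n)`: the number of distinct factors of length `n` of the infinite
word `w`. The alphabet is finite, so the set that is counted is finite. -/
noncomputable def complexity {d : ℕ} (w : ℕ → Fin d) (n : ℕ) : ℕ :=
  Set.ncard {u : Fin n → Fin d | IsFactor u w}

/-- The number of occurrences of the letter `a` among the first `n` letters of `w`. -/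
def prefixCount {d : ℕ} (w : ℕ → Fin d) (n : ℕ) (a : Fin d) : ℕ :=
  ((Finset.range n).filter (fun i => w i = a)).card

/-- The letter frequencies of `w` exist and are the numbers `f a`: for each letter `a`, the
proportion of `a` in the prefix of length `n` tends to `f a` as `n` tends to infinity. -/
def HasLetterFrequencies {d : ℕ} (w : ℕ → Fin d) (f : Fin d → ℝ) : Prop :=
  ∀ a : Fin d,
    Filter.Tendsto (fun n : ℕ => (prefixCount w n a : ℝ) / (n : ℝ)) Filter.atTop (nhds (f a))

/-- The letter frequencies of `w` exist and are linearly independent over `ℚ`. -/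
def HasRationallyIndependentFrequencies {d : ℕ} (w : ℕ → Fin d) : Prop :=
  ∃ f : Fin d → ℝ, HasLetterFrequencies w f ∧ LinearIndependent ℚ f

/-! Lower bound: `w` is a walk on the Rauzy graph, whose vertices are the factors of length `n` and
whose edges are those of length `n + 1`. If a rational letter weight `c` is the coboundary of a
potential `φ` on the vertices, its partial sums along `w` telescope and stay bounded, so `c` is
orthogonal to the frequencies and vanishes. Hence `coboundaryDefect` is injective, and counting
dimensions gives `complexity_add_le_complexity_succ`: each step adds at least `d - 1` factors.

Sharpness: code the orbit of `0` under a rotation by `d` intervals with rationally independent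
lengths. A block of length `n` changes only at backward iterates of the interval endpoints. Taking
the first length `S 1` as the angle makes two of these backward orbits overlap
(`card_cutPoints_le`), which leaves at most `(d - 1) * n + 1` blocks. Equidistribution makes the
lengths the letter frequencies. -/

/-- The set of factors of length `n` of `w`. -/
abbrev FactorSet {d : ℕ} (w : ℕ → Fin d) (n : ℕ) : Type :=
  {u : Fin n → Fin d // IsFactor u w}

/-- The factor of length `n` of `w` that starts at position `i`. -/
def factorAt {d : ℕ} (w : ℕ → Fin d) (n i : ℕ) : FactorSet w n :=
  ⟨fun j => w (i + j), i, fun _ => rfl⟩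

theorem factorAt_surjective {d : ℕ} (w : ℕ → Fin d) (n : ℕ) :
    Function.Surjective (factorAt w n) := by
  rintro ⟨u, i, hu⟩
  exact ⟨i, Subtype.ext (funext fun j => (hu j).symm)⟩

/-- Deleting the last letter of a factor. -/
def FactorSet.init {d : ℕ} {w : ℕ → Fin d} {n : ℕ} (e : FactorSet w (n + 1)) : FactorSet w n :=
  ⟨fun j => e.1 j.castSucc, e.2.imp fun i hi j => by simpa using hi j.castSucc⟩

/-- Deleting the first letter of a factor. -/
def FactorSet.tail {d : ℕ} {w : ℕ → Fin d} {n : ℕ} (e : FactorSet w (n + 1)) : FactorSet w n :=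
  ⟨fun j => e.1 j.succ, by
    obtain ⟨i, hi⟩ := e.2
    exact ⟨i + 1, fun j => (hi j.succ).trans (by rw [Fin.val_succ]; congr 1; ring)⟩⟩

theorem init_factorAt {d : ℕ} (w : ℕ → Fin d) (n i : ℕ) :
    (factorAt w (n + 1) i).init = factorAt w n i := rfl

theorem tail_factorAt {d : ℕ} (w : ℕ → Fin d) (n i : ℕ) :
    (factorAt w (n + 1) i).tail = factorAt w n (i + 1) := by
  refine Subtype.ext (funext fun j => ?_)
  change w (i + (j.succ : ℕ)) = w (i + 1 + j)
  rw [Fin.val_succ]; congr 1; ring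

/-! ### Lower bound: coboundaries on the Rauzy graph -/

/-- A weight `c` on the letters together with a potential `φ` on the factors of length `n` is sent
to the function on the edges of the Rauzy graph that measures the failure of `c` to be the
coboundary of `φ`, together with the value of `φ` at the initial factor. -/
def coboundaryDefect {d : ℕ} (w : ℕ → Fin d) (n : ℕ) :
    ((Fin d → ℚ) × (FactorSet w n → ℚ)) →ₗ[ℚ] ((FactorSet w (n + 1) → ℚ) × ℚ) where
  toFun p := (fun e => p.1 (e.1 0) - (p.2 e.tail - p.2 e.init), p.2 (factorAt w n 0))
  map_add' p q := by
    ext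
    · simp; ring
    · simp
  map_smul' r p := by
    ext
    · simp; ring
    · simp

theorem sum_eq_of_coboundaryDefect_eq_zero {d : ℕ} {w : ℕ → Fin d} {n : ℕ}
    {c : Fin d → ℚ} {φ : FactorSet w n → ℚ} (h : coboundaryDefect w n (c, φ) = 0) (N : ℕ) :
    ∑ i ∈ Finset.range N, c (w i) = φ (factorAt w n N) := by
  have h0 : φ (factorAt w n 0) = 0 := congrArg Prod.snd h
  induction N with
  | zero => simp [h0]
  | succ N ih =>
    have h1 := congrFun (congrArg Prod.fst h) (factorAt w (n + 1) N)
    have h2 : c (w N) - (φ (factorAt w n (N + 1)) - φ (factorAt w n N)) = 0 := by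
      rw [← tail_factorAt, ← init_factorAt w n N]
      exact h1
    rw [Finset.sum_range_succ, ih]
    linarith

theorem sum_letters_eq_sum_prefixCount {d : ℕ} (w : ℕ → Fin d) (c : Fin d → ℝ) (N : ℕ) :
    ∑ i ∈ Finset.range N, c (w i) = ∑ a, c a * (prefixCount w N a : ℝ) := by
  rw [← Finset.sum_fiberwise (Finset.range N) w]
  refine Finset.sum_congr rfl fun a _ => ?_
  rw [prefixCount, Finset.sum_congr rfl (g := fun _ => c a)]
  · rw [Finset.sum_const, nsmul_eq_mul, mul_comm]
  · intro i hi
    rw [(Finset.mem_filter.1 hi).2]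

/-- A letter weight whose partial sums along `w` stay bounded is orthogonal to the
frequencies. -/
theorem sum_mul_frequency_eq_zero {d : ℕ} {w : ℕ → Fin d} {f : Fin d → ℝ}
    (hf : HasLetterFrequencies w f) (c : Fin d → ℝ) (B : ℝ)
    (hB : ∀ N, |∑ i ∈ Finset.range N, c (w i)| ≤ B) : ∑ a, c a * f a = 0 := by
  have h1 : Filter.Tendsto (fun N : ℕ => ∑ a, c a * ((prefixCount w N a : ℝ) / (N : ℝ)))
      Filter.atTop (nhds (∑ a, c a * f a)) :=
    tendsto_finsetSum _ fun a _ => (hf a).const_mul (c a)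
  refine tendsto_nhds_unique h1 ?_
  refine squeeze_zero_norm (a := fun N : ℕ => B / (N : ℝ)) (fun N => ?_)
    (tendsto_const_div_atTop_nhds_zero_nat B)
  have h2 : ∑ a, c a * ((prefixCount w N a : ℝ) / (N : ℝ))
      = (∑ i ∈ Finset.range N, c (w i)) / N := by
    rw [sum_letters_eq_sum_prefixCount, Finset.sum_div]
    exact Finset.sum_congr rfl fun a _ => by ring
  rw [h2, Real.norm_eq_abs, abs_div, Nat.abs_cast]
  exact div_le_div_of_nonneg_right (hB N) (Nat.cast_nonneg N)

theorem coboundaryDefect_injective {d : ℕ} {w : ℕ → Fin d}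
    (hw : HasRationallyIndependentFrequencies w) (n : ℕ) :
    Function.Injective (coboundaryDefect w n) := by
  classical
  rw [← LinearMap.ker_eq_bot, LinearMap.ker_eq_bot']
  rintro ⟨c, φ⟩ h
  obtain ⟨f, hf, hind⟩ := hw
  have hsum := sum_eq_of_coboundaryDefect_eq_zero h
  have hzero : ∑ a, (c a : ℝ) * f a = 0 := by
    -- There are finitely many factors of length `n`, so `∑ |φ v|` bounds every value of `φ`.
    refine sum_mul_frequency_eq_zero hf (fun a => (c a : ℝ)) (∑ v, |(φ v : ℝ)|) fun N => ?_
    have h1 : ∑ i ∈ Finset.range N, (c (w i) : ℝ) = (φ (factorAt w n N) : ℝ) := by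
      rw [← hsum N]; push_cast; rfl
    rw [h1]
    exact Finset.single_le_sum (f := fun v => |(φ v : ℝ)|) (fun v _ => abs_nonneg _)
      (Finset.mem_univ _)
  have hc : c = 0 := by
    refine funext (Fintype.linearIndependent_iff.1 hind c ?_)
    simpa only [Rat.smul_def] using hzero
  have hφ : φ = 0 := by
    -- With `c = 0` the potential is constant along `w`, with initial value `0`, and `w` visits
    -- every vertex.
    funext v
    obtain ⟨N, rfl⟩ := factorAt_surjective w n v
    rw [← hsum N, hc]
    simp
  rw [hc, hφ]
  rfl

theorem finrank_factorSet {d : ℕ} (w : ℕ → Fin d) (n : ℕ) :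
    Module.finrank ℚ (FactorSet w n → ℚ) = complexity w n := by
  classical
  rw [Module.finrank_fintype_fun_eq_card, ← Nat.card_eq_fintype_card]
  exact Nat.card_coe_set_eq {u : Fin n → Fin d | IsFactor u w}

/-- The `+ 1` is the coordinate of `coboundaryDefect` that normalises `φ` at the initial factor and
so excludes constant potentials. -/
theorem complexity_add_le_complexity_succ {d : ℕ} {w : ℕ → Fin d}
    (hw : HasRationallyIndependentFrequencies w) (n : ℕ) :
    d + complexity w n ≤ complexity w (n + 1) + 1 := by
  have h := LinearMap.finrank_le_finrank_of_injective (coboundaryDefect_injective hw n)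
  rwa [Module.finrank_prod, Module.finrank_prod, finrank_factorSet, finrank_factorSet,
    Module.finrank_fin_fun, Module.finrank_self] at h

theorem le_complexity {d : ℕ} (hd : 1 ≤ d) {w : ℕ → Fin d}
    (hw : HasRationallyIndependentFrequencies w) (n : ℕ) :
    (d - 1) * n + 1 ≤ complexity w n := by
  induction n with
  | zero =>
    have : 0 < complexity w 0 := (Set.ncard_pos (Set.toFinite _)).2
      ⟨_, (factorAt w 0 0).2⟩
    omega
  | succ n ih =>
    have h := complexity_add_le_complexity_succ hw n
    rw [mul_add]
    omega

/-! ### Equidistribution of irrational rotations -/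

/-- The number of `i < n` such that the fractional part of `i * α` is less than `t`. -/
noncomputable def rotationCount (α t : ℝ) (n : ℕ) : ℕ :=
  ((Finset.range n).filter (fun i : ℕ => Int.fract (i * α) < t)).card

theorem rotationCount_mono (α : ℝ) {s t : ℝ} (h : s ≤ t) (n : ℕ) :
    rotationCount α s n ≤ rotationCount α t n :=
  Finset.card_le_card (Finset.monotone_filter_right _ fun _ _ hi => lt_of_lt_of_le hi h)

theorem rotationCount_le (α t : ℝ) (n : ℕ) : rotationCount α t n ≤ n :=
  (Finset.card_filter_le _ _).trans_eq (Finset.card_range n)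

/-- Subtracting `t` wraps around the circle exactly when `fract x < fract t`. For `t = k * α` this
makes the indicator minus its mean a coboundary of the rotation. -/
theorem indicator_fract_lt_fract (x t : ℝ) :
    (if Int.fract x < Int.fract t then (1 : ℝ) else 0)
      = Int.fract (x - t) - Int.fract x + Int.fract t := by
  have hx := Int.fract_add_floor x
  have ht := Int.fract_add_floor t
  have hx0 := Int.fract_nonneg x
  have hx1 := Int.fract_lt_one x
  have ht0 := Int.fract_nonneg t
  have ht1 := Int.fract_lt_one t
  split_ifs with h
  · have h1 : Int.fract (x - t) = Int.fract x - Int.fract t + 1 :=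
      Int.fract_eq_iff.2 ⟨by linarith, by linarith, ⌊x⌋ - ⌊t⌋ - 1, by push_cast; linarith⟩
    rw [h1]; ring
  · have h1 : Int.fract (x - t) = Int.fract x - Int.fract t :=
      Int.fract_eq_iff.2 ⟨by linarith, by linarith, ⌊x⌋ - ⌊t⌋, by push_cast; linarith⟩
    rw [h1]; ring

/-- The difference of the sums of a bounded sequence over an interval and over its translate is
bounded independently of the length of the interval. -/
theorem exists_bound_sum_translate (g : ℤ → ℝ) (hg : ∀ i, |g i| ≤ 1) (k : ℤ) :
    ∃ B, ∀ n : ℕ, |∑ i ∈ Finset.range n, (g (i - k) - g i)| ≤ B := by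
  -- A shift by one telescopes to two boundary terms, each at most `1` in absolute value.
  have step : ∀ (k : ℤ) (n : ℕ),
      |∑ i ∈ Finset.range n, (g (i - (k + 1)) - g (i - k))| ≤ 2 := by
    intro k n
    have h : ∀ i : ℕ, g (i - (k + 1)) - g (i - k)
        = g ((i : ℕ) - (k + 1)) - g (((i + 1 : ℕ) : ℤ) - (k + 1)) := by
      intro i; congr 2; push_cast; ring
    rw [Finset.sum_congr rfl fun i _ => h i,
      Finset.sum_range_sub' (fun i : ℕ => g ((i : ℤ) - (k + 1)))]
    exact (abs_sub _ _).trans (by linarith [hg ((0 : ℕ) - (k + 1)), hg ((n : ℤ) - (k + 1))])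
  induction k using Int.induction_on with
  | zero => exact ⟨0, fun n => by simp⟩
  | succ k ih =>
    obtain ⟨B, hB⟩ := ih
    refine ⟨2 + B, fun n => ?_⟩
    have h : ∑ i ∈ Finset.range n, (g (i - (k + 1)) - g i)
        = ∑ i ∈ Finset.range n, (g (i - (k + 1)) - g (i - k))
          + ∑ i ∈ Finset.range n, (g (i - k) - g i) := by
      rw [← Finset.sum_add_distrib]
      exact Finset.sum_congr rfl fun i _ => by ring
    rw [h]
    exact (abs_add_le _ _).trans (add_le_add (step k n) (hB n))
  | pred k ih =>
    obtain ⟨B, hB⟩ := ih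
    refine ⟨B + 2, fun n => ?_⟩
    have h : ∑ i ∈ Finset.range n, (g (i - (-k - 1)) - g i)
        = ∑ i ∈ Finset.range n, (g (i - (-k)) - g i)
          - ∑ i ∈ Finset.range n, (g (i - ((-k - 1) + 1)) - g (i - (-k - 1))) := by
      rw [← Finset.sum_sub_distrib]
      exact Finset.sum_congr rfl fun i _ => by rw [sub_add_cancel]; ring
    rw [h]
    exact (abs_sub _ _).trans (add_le_add (hB n) (step _ n))

/-- The initial intervals whose length lies on the orbit of `0` are bounded remainder sets. -/
theorem tendsto_rotationCount_fract (α : ℝ) (k : ℤ) :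
    Filter.Tendsto (fun n : ℕ => (rotationCount α (Int.fract (k * α)) n : ℝ) / n)
      Filter.atTop (nhds (Int.fract (k * α))) := by
  obtain ⟨B, hB⟩ := exists_bound_sum_translate (fun i => Int.fract (i * α))
    (fun i => by rw [abs_of_nonneg (Int.fract_nonneg _)]; exact (Int.fract_lt_one _).le) k
  rw [tendsto_iff_norm_sub_tendsto_zero]
  refine squeeze_zero' (Filter.Eventually.of_forall fun n => norm_nonneg _) ?_
    (tendsto_const_div_atTop_nhds_zero_nat B)
  filter_upwards [Filter.eventually_gt_atTop 0] with n hn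
  have hn' : (0 : ℝ) < n := Nat.cast_pos.2 hn
  have h1 : (rotationCount α (Int.fract (k * α)) n : ℝ)
      = ∑ i ∈ Finset.range n, (Int.fract (((i - k : ℤ) : ℝ) * α) - Int.fract (((i : ℤ) : ℝ) * α))
        + n * Int.fract (k * α) := by
    rw [rotationCount, Finset.card_filter]
    push_cast
    rw [Finset.sum_congr rfl fun (i : ℕ) _ => indicator_fract_lt_fract (i * α) (k * α),
      Finset.sum_add_distrib, Finset.sum_const, Finset.card_range, nsmul_eq_mul]
    simp only [sub_mul]
  have h2 : (rotationCount α (Int.fract (k * α)) n : ℝ) / n - Int.fract (k * α)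
      = (∑ i ∈ Finset.range n,
        (Int.fract (((i - k : ℤ) : ℝ) * α) - Int.fract (((i : ℤ) : ℝ) * α))) / n := by
    rw [h1, add_div, mul_div_cancel_left₀ _ hn'.ne', add_sub_cancel_right]
  rw [h2, Real.norm_eq_abs, abs_div, Nat.abs_cast]
  exact div_le_div_of_nonneg_right (hB n) hn'.le

theorem exists_fract_mul_mem_Ioo {α : ℝ} (hα : Irrational α) {a b : ℝ} (ha : 0 ≤ a) (hab : a < b)
    (hb : b ≤ 1) : ∃ k : ℤ, Int.fract (k * α) ∈ Set.Ioo a b := by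
  have hd : Dense (AddSubgroup.closure {α, 1} : Set ℝ) :=
    dense_addSubgroupClosure_pair_iff.2 (by simpa using hα)
  obtain ⟨x, hx, hxa, hxb⟩ := hd.exists_between hab
  obtain ⟨k, m, rfl⟩ := AddSubgroup.mem_closure_pair.1 hx
  refine ⟨k, ?_⟩
  have h : Int.fract (k * α) = k • α + m • (1 : ℝ) :=
    Int.fract_eq_iff.2 ⟨by linarith, by linarith, -m, by simp⟩
  rw [h]
  exact ⟨hxa, hxb⟩

/-- Equidistribution of the orbit of `0` under an irrational rotation, on initial intervals. -/
theorem tendsto_rotationCount {α : ℝ} (hα : Irrational α) {t : ℝ} (h0 : 0 ≤ t) (h1 : t ≤ 1) :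
    Filter.Tendsto (fun n : ℕ => (rotationCount α t n : ℝ) / n) Filter.atTop (nhds t) := by
  refine tendsto_order.2 ⟨fun a ha => ?_, fun b hb => ?_⟩
  · rcases lt_or_ge a 0 with ha0 | ha0
    · exact Filter.Eventually.of_forall fun n => ha0.trans_le (by positivity)
    · obtain ⟨k, hk⟩ := exists_fract_mul_mem_Ioo hα ha0 ha h1
      filter_upwards [(tendsto_order.1 (tendsto_rotationCount_fract α k)).1 a hk.1] with n hn
      refine hn.trans_le (div_le_div_of_nonneg_right ?_ n.cast_nonneg)
      exact_mod_cast rotationCount_mono α hk.2.le n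
  · rcases lt_or_ge 1 b with hb1 | hb1
    · refine Filter.Eventually.of_forall fun n => lt_of_le_of_lt ?_ hb1
      exact div_le_one_of_le₀ (by exact_mod_cast rotationCount_le α t n) n.cast_nonneg
    · obtain ⟨k, hk⟩ := exists_fract_mul_mem_Ioo hα h0 hb hb1
      filter_upwards [(tendsto_order.1 (tendsto_rotationCount_fract α k)).2 b hk.2] with n hn
      refine lt_of_le_of_lt (div_le_div_of_nonneg_right ?_ n.cast_nonneg) hn
      exact_mod_cast rotationCount_mono α hk.1.le n

/-! ### Interval codings and their cut points -/

/-- A real number in `[0, 1)` is coded by the index of the interval `[S a, S (a + 1))` that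
contains it. -/
def IsIntervalCoding {d : ℕ} (S : ℕ → ℝ) (code : ℝ → Fin d) : Prop :=
  ∀ x, 0 ≤ x → x < 1 → S (code x) ≤ x ∧ x < S (code x + 1)

theorem exists_isIntervalCoding {d : ℕ} (hd : 1 ≤ d) {S : ℕ → ℝ} (h0 : S 0 = 0) (h1 : S d = 1) :
    ∃ code : ℝ → Fin d, IsIntervalCoding S code := by
  classical
  have key : ∀ x : ℝ, ∃ a : Fin d, 0 ≤ x → x < 1 → S a ≤ x ∧ x < S (a + 1) := by
    intro x
    by_cases hx : 0 ≤ x ∧ x < 1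
    · have hex : ∃ k, x < S (k + 1) := ⟨d - 1, by rw [Nat.sub_add_cancel hd, h1]; exact hx.2⟩
      have hlt : Nat.find hex < d :=
        lt_of_le_of_lt (Nat.find_min' hex (m := d - 1)
          (by rw [Nat.sub_add_cancel hd, h1]; exact hx.2)) (by omega)
      refine ⟨⟨Nat.find hex, hlt⟩, fun _ _ => ⟨?_, Nat.find_spec hex⟩⟩
      change S (Nat.find hex) ≤ x
      rcases Nat.eq_zero_or_eq_succ_pred (Nat.find hex) with h | h
      · rw [h, h0]; exact hx.1
      · have := Nat.find_min hex (m := (Nat.find hex).pred) (by omega)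
        rw [h]
        exact not_lt.1 this
    · exact ⟨⟨0, hd⟩, fun h h' => absurd ⟨h, h'⟩ hx⟩
  choose code hcode using key
  exact ⟨code, hcode⟩

theorem IsIntervalCoding.eq_iff {d : ℕ} {S : ℕ → ℝ} {code : ℝ → Fin d}
    (hc : IsIntervalCoding S code) (hS : StrictMono S) {x : ℝ} (hx0 : 0 ≤ x) (hx1 : x < 1)
    (a : Fin d) : code x = a ↔ S a ≤ x ∧ x < S (a + 1) := by
  obtain ⟨h1, h2⟩ := hc x hx0 hx1
  refine ⟨fun h => h ▸ ⟨h1, h2⟩, fun ⟨h3, h4⟩ => Fin.ext ?_⟩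
  have h5 := hS.lt_iff_lt.1 (h1.trans_lt h4)
  have h6 := hS.lt_iff_lt.1 (h3.trans_lt h2)
  omega

theorem IsIntervalCoding.eq_of_forall_not_mem_Ioc {d : ℕ} {S : ℕ → ℝ} {code : ℝ → Fin d}
    (hc : IsIntervalCoding S code) (hS : StrictMono S) {p x : ℝ} (hp : 0 ≤ p) (hpx : p ≤ x)
    (hx : x < 1) (h : ∀ j < d, ¬(p < S j ∧ S j ≤ x)) : code p = code x := by
  obtain ⟨h1, h2⟩ := hc x (hp.trans hpx) hx
  refine (hc.eq_iff hS hp (hpx.trans_lt hx) _).2 ⟨?_, hpx.trans_lt h2⟩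
  exact not_lt.1 fun h3 => h _ (code x).2 ⟨h3, h1⟩

/-- The coding of the orbit of `0` under the rotation by `α`. -/
noncomputable def rotationWord {d : ℕ} (code : ℝ → Fin d) (α : ℝ) (i : ℕ) : Fin d :=
  code (Int.fract (i * α))

/-- The coding of the first `n` points of the orbit of `x` under the rotation by `α`. -/
noncomputable def rotationBlock {d : ℕ} (code : ℝ → Fin d) (α : ℝ) (n : ℕ) (x : ℝ) :
    Fin n → Fin d :=
  fun k => code (Int.fract (x + (k : ℕ) * α))

theorem IsFactor.exists_eq_rotationBlock {d n : ℕ} {code : ℝ → Fin d} {α : ℝ} {u : Fin n → Fin d}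
    (hu : IsFactor u (rotationWord code α)) :
    ∃ x, 0 ≤ x ∧ x < 1 ∧ u = rotationBlock code α n x := by
  obtain ⟨i, hi⟩ := hu
  refine ⟨Int.fract (i * α), Int.fract_nonneg _, Int.fract_lt_one _, funext fun k => ?_⟩
  rw [hi k, rotationWord, rotationBlock]
  congr 1
  refine Int.fract_eq_fract.2 ⟨⌊(i : ℝ) * α⌋, ?_⟩
  have := Int.fract_add_floor ((i : ℝ) * α)
  push_cast
  linarith

/-- The points of `[0, 1)` that some of the first `n` iterates of the rotation by `α` send to one
of the points `S j`. -/
noncomputable def cutPoints (d : ℕ) (S : ℕ → ℝ) (α : ℝ) (n : ℕ) : Finset ℝ :=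
  (Finset.range d ×ˢ Finset.range n).image fun q => Int.fract (S q.1 - q.2 * α)

theorem IsIntervalCoding.rotationBlock_eq {d : ℕ} {S : ℕ → ℝ} {code : ℝ → Fin d}
    (hc : IsIntervalCoding S code) (hS : StrictMono S) (h0 : S 0 = 0) (hd : 1 ≤ d) {α : ℝ} {n : ℕ}
    {p x : ℝ} (hp : 0 ≤ p) (hpx : p ≤ x) (hx : x < 1)
    (h : ∀ y ∈ cutPoints d S α n, ¬(p < y ∧ y ≤ x)) :
    rotationBlock code α n p = rotationBlock code α n x := by
  funext k
  have hcut : ∀ j < d, ∀ m : ℤ, p < S j + m - (k : ℕ) * α → ¬S j + m - (k : ℕ) * α ≤ x := by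
    intro j hj m h1 h2
    refine h (S j + m - (k : ℕ) * α) (Finset.mem_image.2 ⟨(j, k), ?_, ?_⟩) ⟨h1, h2⟩
    · exact Finset.mem_product.2 ⟨Finset.mem_range.2 hj, Finset.mem_range.2 k.2⟩
    · exact Int.fract_eq_iff.2 ⟨by linarith, by linarith, -m, by push_cast; ring⟩
  have hm := Int.floor_le (x + (k : ℕ) * α)
  have hm' := Int.lt_floor_add_one (x + (k : ℕ) * α)
  have hfx := Int.fract_add_floor (x + (k : ℕ) * α)
  generalize hmdef : ⌊x + (k : ℕ) * α⌋ = m at hm hm' hfx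
  -- The cut `S 0 = 0` prevents the integer part from changing between `p + k * α` and `x + k * α`.
  have hmp : (m : ℝ) ≤ p + (k : ℕ) * α := by
    by_contra! hlt
    exact hcut 0 hd m (by rw [h0]; linarith) (by rw [h0]; linarith)
  have hfp : Int.fract (p + (k : ℕ) * α) = p + (k : ℕ) * α - m :=
    Int.fract_eq_iff.2 ⟨by linarith, by linarith, m, by ring⟩
  refine hc.eq_of_forall_not_mem_Ioc hS (Int.fract_nonneg _) (by linarith) (Int.fract_lt_one _) ?_
  rintro j hj ⟨h1, h2⟩
  exact hcut j hj m (by linarith) (by linarith)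

theorem IsIntervalCoding.exists_cutPoint {d : ℕ} {S : ℕ → ℝ} {code : ℝ → Fin d}
    (hc : IsIntervalCoding S code) (hS : StrictMono S) (h0 : S 0 = 0) (hd : 1 ≤ d) {α : ℝ} {n : ℕ}
    (hn : 1 ≤ n) {x : ℝ} (hx0 : 0 ≤ x) (hx : x < 1) :
    ∃ p ∈ cutPoints d S α n, rotationBlock code α n p = rotationBlock code α n x := by
  -- The witness is the largest cut point not exceeding `x`; one exists because `0` is a cut point
  -- when `n ≥ 1`.
  have hne : ((cutPoints d S α n).filter (· ≤ x)).Nonempty := by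
    refine ⟨0, Finset.mem_filter.2 ⟨Finset.mem_image.2 ⟨(0, 0), ?_, by simp [h0]⟩, hx0⟩⟩
    exact Finset.mem_product.2 ⟨Finset.mem_range.2 hd, Finset.mem_range.2 hn⟩
  obtain ⟨hp, hpx⟩ := Finset.mem_filter.1 (Finset.max'_mem _ hne)
  have hp0 : 0 ≤ ((cutPoints d S α n).filter (· ≤ x)).max' hne := by
    obtain ⟨q, -, hq⟩ := Finset.mem_image.1 hp
    rw [← hq]
    exact Int.fract_nonneg _
  refine ⟨_, hp, hc.rotationBlock_eq hS h0 hd hp0 hpx hx ?_⟩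
  rintro y hy ⟨h1, h2⟩
  exact absurd (Finset.le_max' _ y (Finset.mem_filter.2 ⟨hy, h2⟩)) (not_le.2 h1)

/-- When the rotation sends the cut `0` to the cut `S 1`, their backward orbits overlap. -/
theorem card_cutPoints_le {d : ℕ} (hd : 2 ≤ d) {S : ℕ → ℝ} (h0 : S 0 = 0) (n : ℕ) :
    (cutPoints d S (S 1) n).card ≤ (d - 1) * n + 1 := by
  classical
  have hsub : cutPoints d S (S 1) n ⊆ insert (Int.fract (S 1))
      ((((Finset.range d).erase 1) ×ˢ Finset.range n).image
        fun q => Int.fract (S q.1 - q.2 * S 1)) := by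
    intro y hy
    obtain ⟨⟨j, k⟩, hjk, rfl⟩ := Finset.mem_image.1 hy
    simp only [Finset.mem_product, Finset.mem_range] at hjk
    by_cases hj : j = 1
    · subst hj
      rcases k with _ | k
      · simp
      -- Since `S 1 - (k + 1) * S 1 = 0 - k * S 1`, only time `0` of the cut `S 1` is new.
      · refine Finset.mem_insert_of_mem (Finset.mem_image.2 ⟨(0, k), ?_, ?_⟩)
        · simp; omega
        · simp only [h0]
          congr 1
          push_cast
          ring
    · exact Finset.mem_insert_of_mem (Finset.mem_image.2 ⟨(j, k), by simp [hj, hjk], rfl⟩)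
  refine (Finset.card_le_card hsub).trans ((Finset.card_insert_le _ _).trans ?_)
  refine Nat.succ_le_succ (Finset.card_image_le.trans_eq ?_)
  rw [Finset.card_product, Finset.card_erase_of_mem (Finset.mem_range.2 hd), Finset.card_range,
    Finset.card_range]

theorem IsIntervalCoding.complexity_rotationWord_le {d : ℕ} (hd : 2 ≤ d) {S : ℕ → ℝ}
    {code : ℝ → Fin d} (hc : IsIntervalCoding S code) (hS : StrictMono S) (h0 : S 0 = 0) {n : ℕ}
    (hn : 1 ≤ n) : complexity (rotationWord code (S 1)) n ≤ (d - 1) * n + 1 := by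
  classical
  have hsub : {u : Fin n → Fin d | IsFactor u (rotationWord code (S 1))}
      ⊆ ((cutPoints d S (S 1) n).image (rotationBlock code (S 1) n) : Finset (Fin n → Fin d)) := by
    intro u hu
    obtain ⟨x, hx0, hx1, rfl⟩ := IsFactor.exists_eq_rotationBlock hu
    obtain ⟨p, hp, hpx⟩ := hc.exists_cutPoint hS h0 (by omega) (α := S 1) hn hx0 hx1
    exact Finset.mem_coe.2 (Finset.mem_image.2 ⟨p, hp, hpx⟩)
  calc complexity (rotationWord code (S 1)) n
      ≤ ((cutPoints d S (S 1) n).image (rotationBlock code (S 1) n)).card := by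
        rw [← Set.ncard_coe_finset]
        exact Set.ncard_le_ncard hsub (Finset.finite_toSet _)
    _ ≤ (cutPoints d S (S 1) n).card := Finset.card_image_le
    _ ≤ (d - 1) * n + 1 := card_cutPoints_le hd h0 n

theorem IsIntervalCoding.prefixCount_rotationWord {d : ℕ} {S : ℕ → ℝ} {code : ℝ → Fin d}
    (hc : IsIntervalCoding S code) (hS : StrictMono S) (α : ℝ) (n : ℕ) (a : Fin d) :
    prefixCount (rotationWord code α) n a + rotationCount α (S a) n
      = rotationCount α (S (a + 1)) n := by
  simp only [prefixCount, rotationCount, Finset.card_filter]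
  rw [← Finset.sum_add_distrib]
  refine Finset.sum_congr rfl fun i _ => ?_
  have h := hc.eq_iff hS (Int.fract_nonneg (i * α)) (Int.fract_lt_one _) a
  have hlt : S a < S (a + 1) := hS (Nat.lt_succ_self _)
  rw [rotationWord, if_congr h rfl rfl]
  by_cases h1 : Int.fract (i * α) < S a
  · simp [h1, h1.trans hlt]
  · simp [h1, not_lt.1 h1]

theorem IsIntervalCoding.hasLetterFrequencies {d : ℕ} {S : ℕ → ℝ} {code : ℝ → Fin d}
    (hc : IsIntervalCoding S code) (hS : StrictMono S) (h0 : S 0 = 0) (h1 : S d = 1) {α : ℝ}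
    (hα : Irrational α) :
    HasLetterFrequencies (rotationWord code α) fun a => S (a + 1) - S a := by
  have hmem : ∀ k ≤ d, 0 ≤ S k ∧ S k ≤ 1 := fun k hk =>
    ⟨h0 ▸ hS.monotone (Nat.zero_le k), h1 ▸ hS.monotone hk⟩
  intro a
  have ha := hmem a a.2.le
  have hb := hmem (a + 1) a.2
  refine ((tendsto_rotationCount hα hb.1 hb.2).sub (tendsto_rotationCount hα ha.1 ha.2)).congr
    fun n => ?_
  rw [← hc.prefixCount_rotationWord hS α n a, ← sub_div]
  push_cast
  rw [add_sub_cancel_right]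

/-! ### Choice of the lengths and conclusion -/

/-- Sign changes and a common real scaling preserve independence over `ℚ`, so any `d` independent
reals can be made positive and normalised. -/
theorem exists_linearIndependent_pos_sum_eq_one {d : ℕ} (hd : 1 ≤ d) :
    ∃ f : Fin d → ℝ, LinearIndependent ℚ f ∧ (∀ a, 0 < f a) ∧ ∑ a, f a = 1 := by
  obtain ⟨x, hx⟩ := exists_linearIndependent_of_le_rank (R := ℚ) (M := ℝ) (n := d)
    (by
      rw [Real.rank_rat_real]
      exact (Cardinal.natCast_lt_aleph0.trans Cardinal.aleph0_lt_continuum).le)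
  have hpos : ∀ a, 0 < |x a| := fun a => abs_pos.2 (hx.ne_zero a)
  have hT : 0 < ∑ a, |x a| := Finset.sum_pos (fun a _ => hpos a) ⟨⟨0, hd⟩, Finset.mem_univ _⟩
  have hsign : ∀ a, ∃ s : ℚ, s ≠ 0 ∧ |x a| = s * x a := fun a => by
    rcases abs_choice (x a) with h | h
    · exact ⟨1, one_ne_zero, by simp [h]⟩
    · exact ⟨-1, by norm_num, by simp [h]⟩
  choose s hs0 hs using hsign
  refine ⟨fun a => |x a| / ∑ b, |x b|, ?_, fun a => div_pos (hpos a) hT, ?_⟩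
  · rw [Fintype.linearIndependent_iff] at hx ⊢
    intro g hg a
    have h1 : ∑ a, (g a * s a) • x a = (∑ a, g a • (|x a| / ∑ b, |x b|)) * ∑ b, |x b| := by
      rw [Finset.sum_mul]
      refine Finset.sum_congr rfl fun a _ => ?_
      rw [Rat.smul_def, Rat.smul_def, mul_assoc, div_mul_cancel₀ _ hT.ne', hs a]
      push_cast
      ring
    have h2 := hx (fun a => g a * s a) (by rw [h1, hg, zero_mul]) a
    exact (mul_eq_zero.1 h2).resolve_right (hs0 a)
  · rw [← Finset.sum_div, div_self hT.ne']

theorem irrational_of_linearIndependent {d : ℕ} {f : Fin d → ℝ} (hf : LinearIndependent ℚ f)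
    (hsum : ∑ a, f a = 1) {a b : Fin d} (hab : a ≠ b) : Irrational (f a) := by
  rintro ⟨q, hq⟩
  rw [Fintype.linearIndependent_iff] at hf
  -- These coefficients give `q * 1 - f a = 0`; independence then forces `q = 0` at `b` and `q = 1`
  -- at `a`.
  have h := hf (fun c => q - if c = a then 1 else 0) (by
    simp only [sub_smul, Finset.sum_sub_distrib, ← Finset.smul_sum, hsum, ite_smul, one_smul,
      zero_smul, Finset.sum_ite_eq', Finset.mem_univ, if_true]
    rw [Rat.smul_def, hq]
    ring)
  have ha := h a
  have hb := h b
  simp only [if_true, if_neg hab.symm] at ha hb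
  linarith

theorem exists_strictMono_linearIndependent {d : ℕ} (hd : 1 ≤ d) :
    ∃ S : ℕ → ℝ, StrictMono S ∧ S 0 = 0 ∧ S d = 1 ∧
      LinearIndependent ℚ fun a : Fin d => S (a + 1) - S a := by
  obtain ⟨f, hf, hpos, hsum⟩ := exists_linearIndependent_pos_sum_eq_one hd
  -- The default `1` past `d` keeps the partial sums strictly increasing on all of `ℕ`.
  set g : ℕ → ℝ := fun i => if h : i < d then f ⟨i, h⟩ else 1 with hg
  have hgf : ∀ a : Fin d, g a = f a := fun a => by simp [hg]
  refine ⟨fun k => ∑ i ∈ Finset.range k, g i, strictMono_nat_of_lt_succ fun k => ?_, by simp, ?_, ?_⟩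
  · rw [Finset.sum_range_succ, lt_add_iff_pos_right, hg]
    dsimp only
    split_ifs
    exacts [hpos _, one_pos]
  · change ∑ i ∈ Finset.range d, g i = 1
    rw [← Fin.sum_univ_eq_sum_range, ← hsum]
    exact Finset.sum_congr rfl fun a _ => hgf a
  · simpa only [Finset.sum_range_succ, add_sub_cancel_left, hgf] using hf

theorem exists_complexity_le {d : ℕ} (hd : 1 ≤ d) :
    ∃ w : ℕ → Fin d, HasRationallyIndependentFrequencies w ∧
      ∀ n, 1 ≤ n → complexity w n ≤ (d - 1) * n + 1 := by
  obtain ⟨S, hS, h0, h1, hind⟩ := exists_strictMono_linearIndependent hd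
  -- For `d = 1` the angle `S 1 = 1` is rational, so the constant word is used instead.
  rcases hd.eq_or_lt with rfl | hd2
  · refine ⟨fun _ => 0, ⟨fun _ => 1, fun a => ?_, ?_⟩, fun n _ => ?_⟩
    · refine tendsto_const_nhds.congr' ?_
      filter_upwards [Filter.eventually_gt_atTop 0] with n hn
      have : (n : ℝ) ≠ 0 := Nat.cast_ne_zero.2 hn.ne'
      simp [prefixCount, Subsingleton.elim a 0, this]
    · exact LinearIndependent.of_subsingleton (0 : Fin 1) one_ne_zero
    · rw [Nat.sub_self, Nat.zero_mul, Nat.zero_add]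
      exact Set.ncard_le_one_of_subsingleton _
  · obtain ⟨code, hc⟩ := exists_isIntervalCoding hd h0 h1
    have hsum : ∑ a : Fin d, (S (a + 1) - S a) = 1 := by
      rw [Fin.sum_univ_eq_sum_range (fun i => S (i + 1) - S i), Finset.sum_range_sub, h0, h1,
        sub_zero]
    have hα : Irrational (S 1) := by
      have h := irrational_of_linearIndependent hind hsum (a := ⟨0, hd⟩) (b := ⟨1, hd2⟩) (by simp)
      simpa [h0] using h
    exact ⟨rotationWord code (S 1), ⟨_, hc.hasLetterFrequencies hS h0 h1 hα, hind⟩,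
      fun n hn => hc.complexity_rotationWord_le hd2 hS h0 hn⟩

theorem mainTheorem4 (d : ℕ) (hd : 1 ≤ d) :
    (∀ w : ℕ → Fin d, complexity w 1 = d → HasRationallyIndependentFrequencies w →
      ∀ n : ℕ, 1 ≤ n → (d - 1) * n + 1 ≤ complexity w n) ∧
    (∃ w : ℕ → Fin d, complexity w 1 = d ∧ HasRationallyIndependentFrequencies w ∧
      ∀ n : ℕ, 1 ≤ n → complexity w n = (d - 1) * n + 1) := by
  refine ⟨fun w _ hw n _ => le_complexity hd hw n, ?_⟩
  obtain ⟨w, hw, hle⟩ := exists_complexity_le hd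
  have heq : ∀ n : ℕ, 1 ≤ n → complexity w n = (d - 1) * n + 1 := fun n hn =>
    le_antisymm (hle n hn) (le_complexity hd hw n)
  exact ⟨w, by rw [heq 1 le_rfl]; omega, hw, heq⟩
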